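/- Let $\delta\in(0,1)$. There exist constants $d_\delta>0$ and $D_\delta>0$, depending only on $\delta$, such that the following holds. Let $n\ge K\ge 1$ be integers, let $H\in\mathbb R^{n\times K}$ be a deterministic matrix of full rank $K$, let $\gamma\ge 0$, and let $E$ be a random $n\times K$ matrix whose entries are i.i.d. with law $\mathcal N(0,\gamma^2)$ (the point mass at $0$ if $\gamma=0$); put $\hat H=H+E$. For a matrix $A\in\mathbb R^{n\times K}$ let $P_{[A]}$ denote the orthogonal projection of the Euclidean space $\mathbb R^n$ onto the span $[A]$ of the columns of $A$, let $|||\cdot|||$ be the operator norm with respect to the Euclidean norm, and for a positive definite matrix $M$ let $\rho(M)$ and $\rho_{\min}(M)$ be its largest and smallest eigenvalue and $\mathrm{Cond}(M)=\rho(M)/\rho_{\min}(M)$ its condition number. If $$\tfrac14\,\rho_{\min}(H^TH)>d_\delta\, n\,\gamma^2,$$ then, with probability at least $1-\delta$, $$\frac1n\,|||P_{[H]}-P_{[\hat H]}|||^2\le \gamma^2 D_\delta\,\mathrm{Cond}(H^TH)^3\,\frac{1}{\rho_{\min}(H^TH)}.$$ -/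

import Mathlib

open MeasureTheory ProbabilityTheory
open scoped NNReal ENNReal

/-- `[A]`: the subspace of Euclidean space `ℝⁿ` spanned by the columns of the matrix `A`. -/
noncomputable def columnSpan {n K : ℕ} (A : Matrix (Fin n) (Fin K) ℝ) :
    Submodule ℝ (EuclideanSpace ℝ (Fin n)) :=
  Submodule.span ℝ (Set.range fun j : Fin K => WithLp.toLp 2 fun i : Fin n => A i j)

/-- `P_[A]`: the orthogonal projection of Euclidean space `ℝⁿ` onto `[A]`, as an operator on `ℝⁿ`.
The norm on this type is the operator norm. -/
noncomputable def columnProj {n K : ℕ} (A : Matrix (Fin n) (Fin K) ℝ) :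
    EuclideanSpace ℝ (Fin n) →L[ℝ] EuclideanSpace ℝ (Fin n) :=
  (columnSpan A).starProjection

/-- The largest eigenvalue of a real matrix (used for positive definite matrices of size at
least one, whose spectrum is a nonempty finite set of positive reals). -/
noncomputable def rhoMax {K : ℕ} (A : Matrix (Fin K) (Fin K) ℝ) : ℝ :=
  sSup (spectrum ℝ A)

/-- The smallest eigenvalue of a real matrix (used for positive definite matrices of size at
least one). -/
noncomputable def rhoMin {K : ℕ} (A : Matrix (Fin K) (Fin K) ℝ) : ℝ :=
  sInf (spectrum ℝ A)

/-- The condition number of a positive definite matrix: the ratio of its extreme eigenvalues. -/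
noncomputable def condNumber {K : ℕ} (A : Matrix (Fin K) (Fin K) ℝ) : ℝ :=
  rhoMax A / rhoMin A

/-- The entries of the random matrix `E` are independent and each has law `N(0, γ²)`. -/
structure IsIIDGaussianMatrix {Ω : Type*} [MeasurableSpace Ω] {n K : ℕ}
    (E : Ω → Matrix (Fin n) (Fin K) ℝ) (γ : ℝ≥0) (μ : Measure Ω) : Prop where
  hasLaw : ∀ i j, HasLaw (fun ω => E ω i j) (gaussianReal 0 (γ ^ 2)) μ
  indep : iIndepFun (fun (p : Fin n × Fin K) (ω : Ω) => E ω p.1 p.2) μ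

/-! Put `c = √ρ_min(HᵀH)`, so `‖Hu‖ ≥ c‖u‖`. If `‖E‖ ≤ c/2`, then `H + E` is still bounded below by
`c/2`. Moving `Hu` to `(H + E)u` and back bounds both one-sided gaps between the column spans,
giving `‖P_[H] - P_[H+E]‖ ≤ 3‖E‖/c` (`norm_columnProj_sub_le`). A union bound over nets in both
spaces shows `‖E‖² ≤ 32tnγ²` outside an event of probability at most `(25e^{-t})^n`
(`IsIIDGaussianMatrix.measureReal_norm_gt_le`). The condition number enters only through `Cond ≥ 1`.
-/

open scoped RealInnerProductSpace

section Nets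

variable {V W : Type*} [NormedAddCommGroup V] [NormedSpace ℝ V] [NormedAddCommGroup W]

/-- The ball of radius `2` in a `d`-dimensional space has a `1`-net with at most `5 ^ d` points. -/
theorem exists_finset_net_ball_two (V : Type*) [NormedAddCommGroup V] [NormedSpace ℝ V]
    [FiniteDimensional ℝ V] :
    ∃ s : Finset V, s.card ≤ 5 ^ Module.finrank ℝ V ∧ (∀ c ∈ s, ‖c‖ ≤ 2) ∧
      ∀ x : V, ‖x‖ ≤ 2 → ∃ c ∈ s, ‖x - c‖ < 1 := by
  classical
  -- A separated set of maximal cardinality is a net; the Besicovitch bound ensures that the maximum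
  -- exists.
  let p : ℕ → Prop := fun m => ∃ s : Finset V, s.card = m ∧ (∀ c ∈ s, ‖c‖ ≤ 2) ∧
    ∀ c ∈ s, ∀ d ∈ s, c ≠ d → 1 ≤ ‖c - d‖
  have hbound : ∀ m, p m → m ≤ 5 ^ Module.finrank ℝ V := by
    rintro m ⟨s, rfl, hs, hsep⟩
    exact Besicovitch.card_le_of_separated s hs hsep
  have hp0 : p 0 := ⟨∅, by simp⟩
  obtain ⟨s, hcard, hs, hsep⟩ : p (Nat.findGreatest p (5 ^ Module.finrank ℝ V)) :=
    Nat.findGreatest_spec (Nat.zero_le _) hp0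
  refine ⟨s, Besicovitch.card_le_of_separated s hs hsep, hs, fun x hx => ?_⟩
  by_contra! hfar
  have hxs : x ∉ s := fun h => by simpa using (hfar x h).trans_lt' zero_lt_one
  have hp : p (s.card + 1) := by
    refine ⟨insert x s, Finset.card_insert_of_notMem hxs, ?_, ?_⟩
    · simpa using ⟨hx, hs⟩
    · intro c hc d hd hcd
      rcases Finset.mem_insert.1 hc with hcx | hcs
      · rcases Finset.mem_insert.1 hd with hdx | hds
        · exact absurd (hcx.trans hdx.symm) hcd
        · exact hcx ▸ hfar d hds
      · rcases Finset.mem_insert.1 hd with hdx | hds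
        · rw [norm_sub_rev, hdx]; exact hfar c hcs
        · exact hsep c hcs d hds hcd
  have := Nat.le_findGreatest (hbound _ hp) hp
  omega

/-- For a unit `x`, approximating `2x` to within `1` gives `2‖Tx‖ ≤ M + ‖T‖`, and `‖T‖` is absorbed.
Radius `2` makes this lossless. -/
theorem opNorm_le_of_net [NormedSpace ℝ W] {s : Finset V}
    (hs : ∀ x : V, ‖x‖ ≤ 2 → ∃ c ∈ s, ‖x - c‖ < 1) (T : V →L[ℝ] W) {M : ℝ}
    (hM : ∀ c ∈ s, ‖T c‖ ≤ M) : ‖T‖ ≤ M := by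
  have hM0 : 0 ≤ M := by
    obtain ⟨c, hc, -⟩ := hs 0 (by simp)
    exact (norm_nonneg _).trans (hM c hc)
  have h : ‖T‖ ≤ (M + ‖T‖) / 2 := by
    refine T.opNorm_le_of_unit_norm (by positivity) fun x hx => ?_
    obtain ⟨c, hc, hxc⟩ := hs ((2 : ℝ) • x) (by simp [norm_smul, hx])
    have h1 : ‖T ((2 : ℝ) • x)‖ = 2 * ‖T x‖ := by simp [norm_smul]
    have h2 : ‖T ((2 : ℝ) • x)‖ ≤ ‖T c‖ + ‖T ((2 : ℝ) • x - c)‖ := by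
      have : T ((2 : ℝ) • x) = T c + T ((2 : ℝ) • x - c) := by rw [← map_add]; simp
      rw [this]; exact norm_add_le _ _
    have h3 : ‖T ((2 : ℝ) • x - c)‖ ≤ ‖T‖ :=
      (T.le_opNorm _).trans (mul_le_of_le_one_right (norm_nonneg _) hxc.le)
    linarith [hM c hc]
  linarith

theorem norm_le_of_inner_net {F : Type*} [NormedAddCommGroup F] [InnerProductSpace ℝ F]
    {s : Finset F} (hs : ∀ x : F, ‖x‖ ≤ 2 → ∃ c ∈ s, ‖x - c‖ < 1) (w : F) {M : ℝ}
    (hM : ∀ c ∈ s, ⟪c, w⟫ ≤ M) : ‖w‖ ≤ M := by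
  rcases eq_or_ne w 0 with rfl | hw
  · obtain ⟨c, hc, -⟩ := hs 0 (by simp)
    simpa using hM c hc
  have hw' : ‖w‖ ≠ 0 := norm_ne_zero_iff.2 hw
  obtain ⟨c, hc, hxc⟩ := hs ((2 * ‖w‖⁻¹) • w) (by
    rw [norm_smul]; simp [hw'])
  have h1 : ⟪(2 * ‖w‖⁻¹) • w, w⟫ = 2 * ‖w‖ := by
    rw [real_inner_smul_left, real_inner_self_eq_norm_sq]; field_simp
  have h2 : ⟪(2 * ‖w‖⁻¹) • w - c, w⟫ ≤ ‖w‖ :=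
    (real_inner_le_norm _ _).trans (mul_le_of_le_one_left (norm_nonneg _) hxc.le)
  rw [inner_sub_left, h1] at h2
  linarith [hM c hc]

end Nets

section Projections

variable {F : Type*} [NormedAddCommGroup F] [InnerProductSpace ℝ F]

theorem norm_starProjection_sub_comp_le (U V : Submodule ℝ F) [U.HasOrthogonalProjection]
    [V.HasOrthogonalProjection] {a : ℝ} (ha : 0 ≤ a)
    (h : ∀ x ∈ U, ∃ y ∈ V, ‖x - y‖ ≤ a * ‖x‖) :
    ‖(1 - V.starProjection) * U.starProjection‖ ≤ a := by
  refine ContinuousLinearMap.opNorm_le_bound _ ha fun x => ?_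
  obtain ⟨y, hy, hxy⟩ := h (U.starProjection x) (U.starProjection_apply_mem x)
  change ‖U.starProjection x - V.starProjection (U.starProjection x)‖ ≤ _
  rw [Submodule.starProjection_minimal]
  refine (ciInf_le ⟨0, Set.forall_mem_range.2 fun _ => norm_nonneg _⟩ (⟨y, hy⟩ : V)).trans ?_
  refine hxy.trans (mul_le_mul_of_nonneg_left ?_ ha)
  exact U.norm_starProjection_apply_le x

/-- The distance of two orthogonal projections is at most the sum of the two one-sided gaps. -/
theorem norm_starProjection_sub_starProjection_le [CompleteSpace F] (U V : Submodule ℝ F)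
    [U.HasOrthogonalProjection] [V.HasOrthogonalProjection] {a b : ℝ} (ha : 0 ≤ a) (hb : 0 ≤ b)
    (hUV : ∀ x ∈ U, ∃ y ∈ V, ‖x - y‖ ≤ a * ‖x‖) (hVU : ∀ x ∈ V, ∃ y ∈ U, ‖x - y‖ ≤ b * ‖x‖) :
    ‖U.starProjection - V.starProjection‖ ≤ a + b := by
  -- The cross terms `P_V P_U` cancel, and taking adjoints preserves the norm.
  have hsplit : U.starProjection - V.starProjection =
      (1 - V.starProjection) * U.starProjection -
        star ((1 - U.starProjection) * V.starProjection) := by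
    rw [star_mul, star_sub, star_one, (isSelfAdjoint_starProjection U).star_eq,
      (isSelfAdjoint_starProjection V).star_eq]
    noncomm_ring
  rw [hsplit]
  refine (norm_sub_le _ _).trans (add_le_add (norm_starProjection_sub_comp_le U V ha hUV) ?_)
  rw [ContinuousLinearMap.star_eq_adjoint, LinearIsometryEquiv.norm_map]
  exact norm_starProjection_sub_comp_le V U hb hVU

end Projections

section Matrices

variable {n K : ℕ}

/-- A matrix as a continuous linear map between Euclidean spaces. -/
noncomputable def euclideanMap (A : Matrix (Fin n) (Fin K) ℝ) :
    EuclideanSpace ℝ (Fin K) →L[ℝ] EuclideanSpace ℝ (Fin n) :=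
  (Matrix.toEuclideanLin A).toContinuousLinearMap

theorem euclideanMap_apply (A : Matrix (Fin n) (Fin K) ℝ) (x : EuclideanSpace ℝ (Fin K)) :
    euclideanMap A x = WithLp.toLp 2 (A.mulVec x.ofLp) := rfl

theorem euclideanMap_add (A B : Matrix (Fin n) (Fin K) ℝ) :
    euclideanMap (A + B) = euclideanMap A + euclideanMap B := by
  simp [euclideanMap]

theorem columnSpan_eq_range (A : Matrix (Fin n) (Fin K) ℝ) :
    columnSpan A = LinearMap.range (Matrix.toEuclideanLin A) := by
  rw [columnSpan, LinearMap.range_eq_map, ← (EuclideanSpace.basisFun (Fin K) ℝ).toBasis.span_eq,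
    Submodule.map_span, ← Set.range_comp]
  congr 2
  ext j i
  simp [Matrix.toLpLin_apply]

theorem mem_columnSpan_iff {A : Matrix (Fin n) (Fin K) ℝ} {x : EuclideanSpace ℝ (Fin n)} :
    x ∈ columnSpan A ↔ ∃ u, euclideanMap A u = x := by
  rw [columnSpan_eq_range]; rfl

theorem inner_euclideanMap (A : Matrix (Fin n) (Fin K) ℝ) (u : EuclideanSpace ℝ (Fin n))
    (v : EuclideanSpace ℝ (Fin K)) :
    ⟪u, euclideanMap A v⟫ = ∑ p : Fin n × Fin K, u p.1 * v p.2 * A p.1 p.2 := by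
  rw [Fintype.sum_prod_type, PiLp.inner_apply]
  refine Finset.sum_congr rfl fun i _ => ?_
  simp only [euclideanMap_apply, Matrix.mulVec, dotProduct, RCLike.inner_apply, conj_trivial,
    Finset.sum_mul]
  exact Finset.sum_congr rfl fun j _ => by ring

/-- The projections onto the column spans of `A` and `A + B` are close when `B` is small. -/
theorem norm_columnProj_sub_le (A B : Matrix (Fin n) (Fin K) ℝ) {c : ℝ} (hc : 0 < c)
    (hA : ∀ u, c * ‖u‖ ≤ ‖euclideanMap A u‖) (hB : ‖euclideanMap B‖ ≤ c / 2) :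
    ‖columnProj A - columnProj (A + B)‖ ≤ 3 * ‖euclideanMap B‖ / c := by
  have hAB : ∀ u, c / 2 * ‖u‖ ≤ ‖euclideanMap (A + B) u‖ := by
    intro u
    have h1 : ‖euclideanMap A u‖ ≤ ‖euclideanMap (A + B) u‖ + ‖euclideanMap B u‖ := by
      have : euclideanMap A u = euclideanMap (A + B) u - euclideanMap B u := by
        simp [euclideanMap_add]
      rw [this]; exact norm_sub_le _ _
    have h2 : ‖euclideanMap B u‖ ≤ c / 2 * ‖u‖ := (euclideanMap B).le_of_opNorm_le hB u
    linarith [hA u]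
  have hgap : ∀ {r t : ℝ} (u : EuclideanSpace ℝ (Fin K)), 0 < r → r * ‖u‖ ≤ t →
      ‖euclideanMap B u‖ ≤ ‖euclideanMap B‖ / r * t := by
    intro r t u hr h
    calc ‖euclideanMap B u‖ ≤ ‖euclideanMap B‖ * ‖u‖ := (euclideanMap B).le_opNorm u
      _ = ‖euclideanMap B‖ / r * (r * ‖u‖) := by field_simp
      _ ≤ _ := by gcongr
  -- The lower bounds `c` and `c / 2` contribute `1 + 2 = 3`.
  have := norm_starProjection_sub_starProjection_le (columnSpan A) (columnSpan (A + B))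
    (a := ‖euclideanMap B‖ / c) (b := ‖euclideanMap B‖ / (c / 2)) (by positivity) (by positivity)
    ?_ ?_
  · refine this.trans (le_of_eq ?_)
    field_simp
    ring
  · intro x hx
    obtain ⟨u, rfl⟩ := mem_columnSpan_iff.1 hx
    refine ⟨_, mem_columnSpan_iff.2 ⟨u, rfl⟩, ?_⟩
    rw [euclideanMap_add, add_apply, sub_add_cancel_left, norm_neg]
    exact hgap u hc (hA u)
  · intro x hx
    obtain ⟨u, rfl⟩ := mem_columnSpan_iff.1 hx
    refine ⟨_, mem_columnSpan_iff.2 ⟨u, rfl⟩, ?_⟩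
    have : euclideanMap (A + B) u - euclideanMap A u = euclideanMap B u := by
      simp [euclideanMap_add]
    rw [this]
    exact hgap u (half_pos hc) (hAB u)

theorem rhoMin_le_of_mem_spectrum {A : Matrix (Fin K) (Fin K) ℝ} {r : ℝ} (hr : r ∈ spectrum ℝ A) :
    rhoMin A ≤ r :=
  csInf_le A.finite_real_spectrum.bddBelow hr

theorem rhoMin_le_rhoMax {A : Matrix (Fin K) (Fin K) ℝ} (hA : rhoMin A ≠ 0) :
    rhoMin A ≤ rhoMax A := by
  refine csInf_le_csSup ?_ A.finite_real_spectrum.bddBelow A.finite_real_spectrum.bddAbove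
  rw [Set.nonempty_iff_ne_empty]
  -- An empty spectrum would give `sInf ∅ = 0`.
  exact fun h => hA (by simp [rhoMin, h])

/-- Subtracting `ρ_min` shifts the spectrum of `AᵀA` into the nonnegative reals, so the difference
is positive semidefinite. -/
theorem rhoMin_mul_norm_sq_le (A : Matrix (Fin n) (Fin K) ℝ) (u : EuclideanSpace ℝ (Fin K)) :
    rhoMin (A.transpose * A) * ‖u‖ ^ 2 ≤ ‖euclideanMap A u‖ ^ 2 := by
  have hherm : (A.transpose * A).IsHermitian := by
    simpa using Matrix.isHermitian_conjTranspose_mul_self A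
  have hpsd : (A.transpose * A - algebraMap ℝ _ (rhoMin (A.transpose * A))).PosSemidef := by
    rw [Matrix.posSemidef_iff_isHermitian_and_spectrum_nonneg]
    refine ⟨hherm.sub ?_, ?_⟩
    · rw [Algebra.algebraMap_eq_smul_one]
      simp [Matrix.IsHermitian]
    · intro r hr
      rw [← spectrum.sub_singleton_eq] at hr
      obtain ⟨s, hs, _, rfl, rfl⟩ := hr
      exact sub_nonneg.2 (rhoMin_le_of_mem_spectrum hs)
  have h := hpsd.dotProduct_mulVec_nonneg u.ofLp
  rw [Algebra.algebraMap_eq_smul_one, Matrix.sub_mulVec, Matrix.smul_mulVec, Matrix.one_mulVec,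
    dotProduct_sub, ← Matrix.mulVec_mulVec, Matrix.dotProduct_mulVec, Matrix.vecMul_transpose] at h
  rw [EuclideanSpace.real_norm_sq_eq, EuclideanSpace.real_norm_sq_eq]
  simp only [euclideanMap_apply]
  simp only [dotProduct, star_trivial, Pi.smul_apply, smul_eq_mul] at h
  rw [Finset.mul_sum]
  have h1 : ∀ i, u.ofLp i * (rhoMin (A.transpose * A) * u.ofLp i) =
    rhoMin (A.transpose * A) * u.ofLp i ^ 2 := fun i => by ring
  simp only [h1, ← pow_two] at h
  linarith

end Matrices

section Gaussian

variable {Ω : Type*} [MeasurableSpace Ω] {μ : Measure Ω} {n K : ℕ}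

theorem hasSubgaussianMGF_of_hasLaw_gaussianReal {X : Ω → ℝ} {v : ℝ≥0}
    (hX : HasLaw X (gaussianReal 0 v) μ) : HasSubgaussianMGF X v μ := by
  refine (HasSubgaussianMGF.id_map_iff hX.aemeasurable).1 ?_
  rw [hX.map_eq]
  refine ⟨fun t => integrable_exp_mul_gaussianReal t, fun t => ?_⟩
  rw [mgf_id_gaussianReal]
  simp

/-- This is the Chernoff bound; the strict inequality in the event keeps it true for `c = 0`, hence
for `γ = 0`. -/
theorem ProbabilityTheory.HasSubgaussianMGF.measureReal_sqrt_lt_le [IsProbabilityMeasure μ] {X : Ω → ℝ} {c : ℝ≥0}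
    (hX : HasSubgaussianMGF X c μ) {b t : ℝ} (hcb : c ≤ b) (ht : 0 ≤ t) :
    μ.real {ω | √(2 * b * t) < X ω} ≤ Real.exp (-t) := by
  rcases eq_or_ne c 0 with rfl | hc
  · have h0 : μ {ω | √(2 * b * t) < X ω} = 0 := by
      have h := hX.ae_eq_zero_of_hasSubgaussianMGF_zero
      rw [Filter.EventuallyEq, ae_iff] at h
      refine measure_mono_null ?_ h
      intro ω hω
      exact ((Real.sqrt_nonneg _).trans_lt hω).ne'
    rw [Measure.real, h0]
    simpa using (Real.exp_pos _).le
  · have hc' : (0 : ℝ) < c := by positivity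
    have hb : 0 < b := hc'.trans_le hcb
    have hsub : {ω | √(2 * b * t) < X ω} ⊆ {ω | √(2 * b * t) ≤ X ω} :=
      Set.ofPred_subset_ofPred.2 fun _ => le_of_lt
    refine (measureReal_mono hsub).trans
      ((hX.measure_ge_le (Real.sqrt_nonneg (2 * b * t))).trans ?_)
    rw [Real.sq_sqrt (by positivity), Real.exp_le_exp, neg_div, neg_le_neg_iff,
      le_div_iff₀ (by positivity)]
    nlinarith

theorem IsIIDGaussianMatrix.hasSubgaussianMGF_inner [IsProbabilityMeasure μ]
    {E : Ω → Matrix (Fin n) (Fin K) ℝ} {γ : ℝ≥0} (hE : IsIIDGaussianMatrix E γ μ)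
    (u : EuclideanSpace ℝ (Fin n)) (v : EuclideanSpace ℝ (Fin K)) :
    HasSubgaussianMGF (fun ω => ⟪u, euclideanMap (E ω) v⟫) (‖u‖₊ ^ 2 * ‖v‖₊ ^ 2 * γ ^ 2) μ := by
  have h := HasSubgaussianMGF.sum_of_iIndepFun (μ := μ) (s := Finset.univ)
    (hE.indep.comp (fun p x => u p.1 * v p.2 * x) fun p => by fun_prop)
    fun p _ => (hasSubgaussianMGF_of_hasLaw_gaussianReal (hE.hasLaw p.1 p.2)).const_mul
      (u p.1 * v p.2)
  simp only [inner_euclideanMap]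
  convert! h using 1
  rw [← NNReal.coe_inj]
  push_cast
  rw [EuclideanSpace.real_norm_sq_eq, EuclideanSpace.real_norm_sq_eq, Finset.sum_mul_sum,
    ← Finset.sum_product', Finset.sum_mul]
  refine Finset.sum_congr rfl fun p _ => ?_
  change _ = (u p.1 * v p.2) ^ 2 * (γ : ℝ) ^ 2
  ring

/-- The operator norm of a tall Gaussian matrix is of order `γ √n` up to a tail event. -/
theorem IsIIDGaussianMatrix.measureReal_norm_gt_le [IsProbabilityMeasure μ]
    {E : Ω → Matrix (Fin n) (Fin K) ℝ} {γ : ℝ≥0} (hE : IsIIDGaussianMatrix E γ μ) (hKn : K ≤ n)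
    {t : ℝ} (ht : 0 ≤ t) :
    μ.real {ω | √(2 * (16 * γ ^ 2) * (t * n)) < ‖euclideanMap (E ω)‖} ≤
      (25 * Real.exp (-t)) ^ n := by
  obtain ⟨s, hs_card, hs_norm, hs⟩ := exists_finset_net_ball_two (EuclideanSpace ℝ (Fin n))
  obtain ⟨s', hs'_card, hs'_norm, hs'⟩ := exists_finset_net_ball_two (EuclideanSpace ℝ (Fin K))
  rw [finrank_euclideanSpace_fin] at hs_card hs'_card
  set r := √(2 * (16 * (γ : ℝ) ^ 2) * (t * n))
  have hsub : {ω | r < ‖euclideanMap (E ω)‖} ⊆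
      ⋃ p ∈ s ×ˢ s', {ω | r < ⟪p.1, euclideanMap (E ω) p.2⟫} := by
    intro ω hω
    by_contra hcon
    simp only [Set.mem_iUnion, Finset.mem_product, Set.mem_ofPred_eq, not_exists, not_lt] at hcon
    refine absurd (opNorm_le_of_net hs' (euclideanMap (E ω)) fun v hv => ?_) (not_le.2 hω)
    exact norm_le_of_inner_net hs _ fun u hu => hcon (u, v) ⟨hu, hv⟩
  refine (measureReal_mono hsub (measure_ne_top _ _)).trans ((measureReal_biUnion_finset_le _ _).trans ?_)
  have htail : ∀ p ∈ s ×ˢ s', μ.real {ω | r < ⟪p.1, euclideanMap (E ω) p.2⟫} ≤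
      Real.exp (-(t * n)) := by
    intro p hp
    rw [Finset.mem_product] at hp
    -- Net points have norm at most `2`, whence the variance proxy `16γ²`.
    refine (hE.hasSubgaussianMGF_inner p.1 p.2).measureReal_sqrt_lt_le ?_ (by positivity)
    have h1 := hs_norm _ hp.1
    have h2 := hs'_norm _ hp.2
    push_cast
    calc ‖p.1‖ ^ 2 * ‖p.2‖ ^ 2 * (γ : ℝ) ^ 2 ≤ 2 ^ 2 * 2 ^ 2 * (γ : ℝ) ^ 2 := by gcongr
      _ = _ := by norm_num
  refine (Finset.sum_le_card_nsmul _ _ _ htail).trans ?_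
  have hcard : ((s ×ˢ s').card : ℝ) ≤ 25 ^ n := by
    have : (s ×ˢ s').card ≤ 25 ^ n := by
      rw [Finset.card_product]
      calc s.card * s'.card ≤ 5 ^ n * 5 ^ n :=
            Nat.mul_le_mul hs_card (hs'_card.trans (Nat.pow_le_pow_right (by norm_num) hKn))
        _ = 25 ^ n := by rw [← mul_pow]; norm_num
    exact_mod_cast this
  rw [nsmul_eq_mul, mul_pow, ← Real.exp_nat_mul, mul_neg, mul_comm (n : ℝ) t]
  gcongr

end Gaussian

theorem mainTheorem8 (δ : ℝ) (hδ_pos : 0 < δ) (hδ_lt : δ < 1) :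
    ∃ d D : ℝ, 0 < d ∧ 0 < D ∧
      ∀ (n K : ℕ), 1 ≤ K →
      ∀ (H : Matrix (Fin n) (Fin K) ℝ), H.rank = K →
      ∀ (γ : ℝ≥0) (Ω : Type*) [MeasurableSpace Ω] (μ : Measure Ω) [IsProbabilityMeasure μ]
        (E : Ω → Matrix (Fin n) (Fin K) ℝ), IsIIDGaussianMatrix E γ μ →
      (1 / 4 : ℝ) * rhoMin (H.transpose * H) > d * (n : ℝ) * (γ : ℝ) ^ 2 →
      ENNReal.ofReal (1 - δ) ≤
        μ {ω | (1 / (n : ℝ)) * ‖columnProj H - columnProj (H + E ω)‖ ^ 2 ≤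
          (γ : ℝ) ^ 2 * D * condNumber (H.transpose * H) ^ 3 *
            (1 / rhoMin (H.transpose * H))} := by
  set t := Real.log (25 / δ)
  have ht : 0 < t := Real.log_pos (by rw [lt_div_iff₀ hδ_pos]; linarith)
  have hexp : 25 * Real.exp (-t) = δ := by
    rw [Real.exp_neg, Real.exp_log (by positivity)]
    field_simp
  refine ⟨32 * t, 9 * (32 * t), by positivity, by positivity, ?_⟩
  intro n K hK H hH γ Ω _ μ _ E hE hd
  have hKn : K ≤ n := by simpa [hH] using H.rank_le_height
  have hn : 0 < n := hK.trans hKn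
  have hn' : (0 : ℝ) < n := by exact_mod_cast hn
  set ρ := rhoMin (H.transpose * H) with hρ_def
  have hρ : 0 < ρ := by
    have : 0 ≤ 32 * t * n * (γ : ℝ) ^ 2 := by positivity
    linarith
  have hcond : 1 ≤ condNumber (H.transpose * H) := by
    rw [condNumber, one_le_div hρ]
    exact rhoMin_le_rhoMax hρ.ne'
  have hH_lower : ∀ u, √ρ * ‖u‖ ≤ ‖euclideanMap H u‖ := by
    intro u
    refine le_of_sq_le_sq ?_ (norm_nonneg _)
    rw [mul_pow, Real.sq_sqrt hρ.le]
    exact rhoMin_mul_norm_sq_le H u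
  set r := √(2 * (16 * (γ : ℝ) ^ 2) * (t * n)) with hr_def
  have hr_sq : r ^ 2 = 32 * t * n * (γ : ℝ) ^ 2 := by
    rw [hr_def, Real.sq_sqrt (by positivity)]; ring
  -- This is where the choice `d = 32t` is used: the hypothesis reads `r² < ρ/4`.
  have hr : r ≤ √ρ / 2 := by
    refine le_of_sq_le_sq ?_ (by positivity)
    rw [div_pow, Real.sq_sqrt hρ.le]
    linarith
  have hbad : μ {ω | r < ‖euclideanMap (E ω)‖} ≤ ENNReal.ofReal δ := by
    rw [← ofReal_measureReal]
    refine ENNReal.ofReal_le_ofReal ((hE.measureReal_norm_gt_le hKn ht.le).trans ?_)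
    rw [hexp]
    exact pow_le_of_le_one hδ_pos.le hδ_lt.le hn.ne'
  have hgood : {ω | r < ‖euclideanMap (E ω)‖}ᶜ ⊆
      {ω | (1 / (n : ℝ)) * ‖columnProj H - columnProj (H + E ω)‖ ^ 2 ≤
          (γ : ℝ) ^ 2 * (9 * (32 * t)) * condNumber (H.transpose * H) ^ 3 * (1 / ρ)} := by
    intro ω hω
    have hω : ‖euclideanMap (E ω)‖ ≤ r := not_lt.1 hω
    have h1 : ‖columnProj H - columnProj (H + E ω)‖ ≤ 3 * r / √ρ :=
      (norm_columnProj_sub_le H (E ω) (Real.sqrt_pos.2 hρ) hH_lower (hω.trans hr)).trans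
        (by gcongr)
    calc 1 / (n : ℝ) * ‖columnProj H - columnProj (H + E ω)‖ ^ 2
        ≤ 1 / (n : ℝ) * (3 * r / √ρ) ^ 2 := by gcongr
      _ = (γ : ℝ) ^ 2 * (9 * (32 * t)) * 1 * (1 / ρ) := by
        rw [div_pow, mul_pow, hr_sq, Real.sq_sqrt hρ.le]
        field_simp
        ring
      _ ≤ _ := by
        gcongr
        exact one_le_pow₀ hcond
  refine le_trans ?_ (measure_mono hgood)
  rw [ENNReal.ofReal_sub _ hδ_pos.le, ENNReal.ofReal_one, tsub_le_iff_right]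
  calc (1 : ℝ≥0∞) = μ Set.univ := measure_univ.symm
    _ = μ ({ω | r < ‖euclideanMap (E ω)‖}ᶜ ∪ {ω | r < ‖euclideanMap (E ω)‖}) := by
      rw [Set.compl_union_self]
    _ ≤ _ := (measure_union_le _ _).trans (by gcongr)
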